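/- Let $d \ge 2$. For a nonempty compact convex set $K \subseteq \mathbb{R}^d$ let $h_K(u) = \sup_{x \in K} x \cdot u$, $u \in S^{d-1}$, be its support function, and let $\nu$ be the uniform probability measure on the unit sphere $S^{d-1}$. For $R > 0$ let $\mathcal{K}_p(R)$ be the class of all nonempty compact convex sets $K \subseteq \mathbb{R}^d$ with $\int_{S^{d-1}} |h_K(u)|^p \, d\nu(u) \le R^p$ if $1 \le p < \infty$, and with $\sup_{u \in S^{d-1}} |h_K(u)| \le R$ if $p = \infty$. Let $\ell_H(C,D) = \max\bigl(\sup_{x \in C}\inf_{y \in D}|x-y|, \sup_{x \in D}\inf_{y \in C}|x-y|\bigr)$ be the Hausdorff metric on the space of nonempty compact convex subsets of $\mathbb{R}^d$, and let $M(\mathcal{K}_p(R), \epsilon; \ell_H)$ be the smallest number of closed $\ell_H$-balls of radius $\epsilon$ in this space whose union contains $\mathcal{K}_p(R)$. There exist positive constants $c_1$ and $c_2$ depending only on $d$ such that for every $1 \le p \le \infty$ and every $R > 0$, $$ \log M(\mathcal{K}_p(R), \epsilon; \ell_H) \le c_2 \left(\frac{R}{\epsilon}\right)^{(d-1)/2}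 \quad \text{for all } \epsilon > 0, $$ $$ \log M(\mathcal{K}_p(R), \epsilon; \ell_H) \ge c_1 \left(\frac{R}{\epsilon}\right)^{(d-1)/2} \quad \text{for all } 0 < \epsilon < R. $$ In particular, the covering number is finite for every $\epsilon > 0$. -/

import Mathlib

open MeasureTheory Metric
open scoped NNReal ENNReal

noncomputable section

/-- Euclidean space `ℝ^d` with the Euclidean norm. -/
abbrev Euc (d : ℕ) : Type := EuclideanSpace ℝ (Fin d)

/-- The support function `h_K(u) = sup_{x ∈ K} x · u`, for `u` in the unit sphere.
`ConvexBody (Euc d)` is the type of all nonempty compact convex subsets of `ℝ^d`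
(with or without interior points); its distance is the Hausdorff distance. -/
def supportFn {d : ℕ} (K : ConvexBody (Euc d)) (u : sphere (0 : Euc d) 1) : ℝ :=
  sSup ((fun x : Euc d => inner ℝ x (u : Euc d)) '' (K : Set (Euc d)))

/-- The uniform probability measure on the unit sphere: normalized surface measure. -/
def uniformSphere (d : ℕ) : Measure (sphere (0 : Euc d) 1) :=
  ((volume : Measure (Euc d)).toSphere Set.univ)⁻¹ • (volume : Measure (Euc d)).toSphere

/-- The class `K_p(R)` of nonempty compact convex sets whose support function satisfies
`∫ |h_K|^p dν ≤ R^p` if `p < ∞`, and `|h_K(u)| ≤ R` for all unit vectors `u` if `p = ∞`. -/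
def convexClass (d : ℕ) (p : ℝ≥0∞) (R : ℝ) : Set (ConvexBody (Euc d)) :=
  {K | (p = ∞ → ∀ u, |supportFn K u| ≤ R) ∧
       (p ≠ ∞ → ∫⁻ u, ENNReal.ofReal (|supportFn K u| ^ p.toReal) ∂(uniformSphere d)
          ≤ ENNReal.ofReal (R ^ p.toReal))}

/-- The metric entropy `log M(F, ε)`, where `M(F, ε)` is the smallest number of closed balls of
radius `ε` of the space `X` (with centers anywhere in `X`) whose union contains `F`.
It takes the value `⊤` if no finite number of balls suffices. -/
def metricEntropy {X : Type*} [PseudoEMetricSpace X] (F : Set X) (ε : ℝ≥0) : EReal :=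
  ENNReal.log (externalCoveringNumber ε F : ℝ≥0∞)

end

noncomputable section

/-! Write d = n + 1. Hausdorff distance is the sup distance between support functions on the unit
sphere. For the upper bound, the class lies in a ball of radius `C * R` with `C` depending only on
d: if x ∈ K, then h_K ≥ |x|/2 on a spherical cap about x/|x| whose measure is bounded below
(`exists_subset_closedBall_of_mem_convexClass`).

Bodies in a ball of radius r are then coded scale by scale. On each facet D of the cube, h_K +
(r/2)|·|² is r-strongly convex, so its conjugate over D is smooth with a quadratic error |e|²/(2r)
at each dual point x + r v₀. Knowing the conjugate up to τ on a grid of spacing t therefore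
determines h_K up to τ + O(t²/r). All vectors of D share one coordinate, so an n-dimensional grid
suffices. Passing from precision η = 2r/4^j to η/4 takes about 2^(jn) grid values, each already
known up to O(η), so each costs only a constant factor. The logarithmic costs form a geometric sum
of order 2^(jn), that is (r/η)^(n/2), with no extra logarithm (`IsCodedBy.refine`,
`exists_isCodedBy_bodiesInBall`).

For the lower bound, take about (R/ε)^(n/2) points on the sphere of radius R at mutual distances of
order √(Rε). Distinct subsets have convex hulls more than 2ε apart, since dropping a point cuts off
a cap of height of order ε. -/

namespace ConvexBody

variable {E : Type*} [NormedAddCommGroup E] [InnerProductSpace ℝ E]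

/-! ### Support functions and the Hausdorff distance -/

/-- The support function of a convex body, on the whole space. -/
def support (K : ConvexBody E) (v : E) : ℝ :=
  sSup ((fun x : E => inner ℝ x v) '' (K : Set E))

lemma isCompact_image_inner (K : ConvexBody E) (v : E) :
    IsCompact ((fun x : E => inner ℝ x v) '' (K : Set E)) :=
  K.isCompact.image (by fun_prop)

lemma inner_le_support (K : ConvexBody E) {x : E} (hx : x ∈ K) (v : E) :
    inner ℝ x v ≤ K.support v :=
  le_csSup (K.isCompact_image_inner v).bddAbove ⟨x, hx, rfl⟩

lemma exists_inner_eq_support (K : ConvexBody E) (v : E) :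
    ∃ x ∈ K, inner ℝ x v = K.support v := by
  obtain ⟨x, hx, h⟩ := (K.isCompact_image_inner v).sSup_mem (K.nonempty.image _)
  exact ⟨x, hx, h⟩

lemma support_le (K : ConvexBody E) {v : E} {c : ℝ} (h : ∀ x ∈ K, inner ℝ x v ≤ c) :
    K.support v ≤ c := by
  obtain ⟨x, hx, hxv⟩ := K.exists_inner_eq_support v
  exact hxv ▸ h x hx

lemma support_smul (K : ConvexBody E) {t : ℝ} (ht : 0 ≤ t) (v : E) :
    K.support (t • v) = t * K.support v := by
  apply le_antisymm
  · refine K.support_le fun x hx => ?_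
    rw [inner_smul_right]
    exact mul_le_mul_of_nonneg_left (K.inner_le_support hx v) ht
  · obtain ⟨x, hx, hxv⟩ := K.exists_inner_eq_support v
    rw [← hxv, ← inner_smul_right]
    exact K.inner_le_support hx _

lemma abs_support_le (K : ConvexBody E) {r : ℝ} (hK : (K : Set E) ⊆ closedBall 0 r) (v : E) :
    |K.support v| ≤ r * ‖v‖ := by
  obtain ⟨x, hx, hxv⟩ := K.exists_inner_eq_support v
  rw [← hxv]
  exact (abs_real_inner_le_norm x v).trans
    (mul_le_mul_of_nonneg_right (mem_closedBall_zero_iff.1 (hK hx)) (norm_nonneg v))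

lemma exists_mem_dist_le_dist (K L : ConvexBody E) {x : E} (hx : x ∈ K) :
    ∃ y ∈ L, dist x y ≤ dist K L := by
  obtain ⟨y, hy, h⟩ := L.isCompact.exists_infDist_eq_dist L.nonempty x
  exact ⟨y, hy, h ▸ infDist_le_hausdorffDist_of_mem hx hausdorffEDist_ne_top⟩

lemma support_le_support_add (K L : ConvexBody E) (v : E) :
    K.support v ≤ L.support v + dist K L * ‖v‖ := by
  refine K.support_le fun x hx => ?_
  obtain ⟨y, hy, hxy⟩ := K.exists_mem_dist_le_dist L hx
  have h1 : inner ℝ x v = inner ℝ y v + inner ℝ (x - y) v := by rw [inner_sub_left]; ring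
  rw [h1]
  refine add_le_add (L.inner_le_support hy v) ((real_inner_le_norm _ _).trans ?_)
  rw [← dist_eq_norm]
  exact mul_le_mul_of_nonneg_right hxy (norm_nonneg v)

/-- Project x to its nearest point y in L. The hyperplane through y orthogonal to x - y supports L,
so in the direction w of x - y the distance |x - y| is at most h_K(w) - h_L(w). -/
lemma exists_mem_dist_le_of_support_le (K L : ConvexBody E) {η : ℝ} (hη : 0 ≤ η)
    (h : ∀ w : E, ‖w‖ = 1 → K.support w ≤ L.support w + η) {x : E} (hx : x ∈ K) :
    ∃ y ∈ (L : Set E), dist x y ≤ η := by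
  obtain ⟨y, hy, hxy⟩ := exists_norm_eq_iInf_of_complete_convex L.nonempty
    L.isCompact.isComplete L.convex x
  have hin := (norm_eq_iInf_iff_real_inner_le_zero L.convex hy).1 hxy
  refine ⟨y, hy, ?_⟩
  rw [dist_eq_norm]
  by_cases h0 : ‖x - y‖ = 0
  · rw [h0]; exact hη
  have hpos : 0 < ‖x - y‖ := lt_of_le_of_ne (norm_nonneg _) (Ne.symm h0)
  have hw : ‖(‖x - y‖⁻¹ : ℝ) • (x - y)‖ = 1 := by
    rw [norm_smul, norm_inv, norm_norm, inv_mul_cancel₀ h0]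
  have h1 := h _ hw
  rw [K.support_smul (by positivity), L.support_smul (by positivity)] at h1
  have h2 : L.support (x - y) ≤ inner ℝ y (x - y) := by
    refine L.support_le fun z hz => ?_
    have := hin z hz
    rw [real_inner_comm, inner_sub_left] at this
    linarith
  have h3 := K.inner_le_support hx (x - y)
  have h4 : inner ℝ x (x - y) - inner ℝ y (x - y) = ‖x - y‖ * ‖x - y‖ := by
    rw [← inner_sub_left, real_inner_self_eq_norm_mul_norm]
  have h5 : ‖x - y‖⁻¹ * (‖x - y‖ * ‖x - y‖) ≤ η := by
    have : ‖x - y‖⁻¹ * (‖x - y‖ * ‖x - y‖)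
        ≤ ‖x - y‖⁻¹ * (K.support (x - y) - L.support (x - y)) :=
      mul_le_mul_of_nonneg_left (by linarith) (by positivity)
    rw [mul_sub] at this
    linarith
  rwa [← mul_assoc, inv_mul_cancel₀ h0, one_mul] at h5

lemma dist_le_of_abs_support_sub_le (K L : ConvexBody E) {η : ℝ} (hη : 0 ≤ η)
    (h : ∀ w : E, ‖w‖ = 1 → |K.support w - L.support w| ≤ η) : dist K L ≤ η := by
  refine hausdorffDist_le_of_mem_dist hη (fun x hx => ?_) (fun x hx => ?_)
  · exact K.exists_mem_dist_le_of_support_le L hη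
      (fun w hw => by linarith [(abs_le.1 (h w hw)).2]) hx
  · exact L.exists_mem_dist_le_of_support_le K hη
      (fun w hw => by linarith [(abs_le.1 (h w hw)).1]) hx

/-! ### Conjugates of regularized support functions -/

/-- The convex conjugate of `v ↦ h_K(v) + (r / 2) ‖v‖²` restricted to `D`. -/
def regConjugate (D : Set E) (r : ℝ) (K : ConvexBody E) (y : E) : ℝ :=
  sSup ((fun v : E => inner ℝ v y - K.support v - r / 2 * ‖v‖ ^ 2) '' D)

/-- Completing the square; this is the source of every quadratic error term below. -/
lemma inner_sub_le_sq_div {r : ℝ} (hr : 0 < r) (v e : E) :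
    inner ℝ v e - r / 2 * ‖v‖ ^ 2 ≤ ‖e‖ ^ 2 / (2 * r) := by
  have h := real_inner_le_norm v e
  have h1 : 0 ≤ (r * ‖v‖ - ‖e‖) ^ 2 / (2 * r) := by positivity
  have h2 : (r * ‖v‖ - ‖e‖) ^ 2 / (2 * r) =
      r / 2 * ‖v‖ ^ 2 - ‖v‖ * ‖e‖ + ‖e‖ ^ 2 / (2 * r) := by field_simp; ring
  linarith

lemma bddAbove_regConjugate (D : Set E) {r : ℝ} (hr : 0 < r) (K : ConvexBody E) (y : E) :
    BddAbove ((fun v : E => inner ℝ v y - K.support v - r / 2 * ‖v‖ ^ 2) '' D) := by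
  obtain ⟨x, hx⟩ := K.nonempty
  refine ⟨‖y - x‖ ^ 2 / (2 * r), ?_⟩
  rintro _ ⟨v, -, rfl⟩
  have h1 := K.inner_le_support hx v
  have h2 := inner_sub_le_sq_div hr v (y - x)
  rw [inner_sub_right, real_inner_comm x v] at h2
  simp only
  linarith

lemma le_regConjugate {D : Set E} {r : ℝ} (hr : 0 < r) (K : ConvexBody E) (y : E) {v : E}
    (hv : v ∈ D) : inner ℝ v y - K.support v - r / 2 * ‖v‖ ^ 2 ≤ regConjugate D r K y :=
  le_csSup (bddAbove_regConjugate D hr K y) ⟨v, hv, rfl⟩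

/-- Lipschitz dependence on the body: a conjugate value is already known up to a multiple of the
current precision, so refining it is cheap. -/
lemma regConjugate_le_add {D : Set E} (hD : D.Nonempty) {r ρ : ℝ} (hr : 0 < r)
    (hρ : ∀ v ∈ D, ‖v‖ ≤ ρ) (K L : ConvexBody E) (y : E) :
    regConjugate D r K y ≤ regConjugate D r L y + ρ * dist K L := by
  refine csSup_le (hD.image _) ?_
  rintro _ ⟨v, hv, rfl⟩
  have h1 := le_regConjugate hr L y hv
  have h2 := L.support_le_support_add K v
  have h3 : dist L K * ‖v‖ ≤ ρ * dist K L := by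
    rw [dist_comm, mul_comm]
    exact mul_le_mul_of_nonneg_right (hρ v hv) dist_nonneg
  simp only
  linarith

/-- Smoothness of the conjugate at the point `x + r v₀` dual to `v₀`. -/
lemma regConjugate_le_of_dual {D : Set E} {r : ℝ} (hr : 0 < r) (K : ConvexBody E) {v₀ x z e : E}
    (hv₀ : v₀ ∈ D) (hx : x ∈ K) (hxv : inner ℝ x v₀ = K.support v₀)
    (he : ∀ v ∈ D, inner ℝ (v - v₀) (z - x - r • v₀) = inner ℝ (v - v₀) e) :
    regConjugate D r K z ≤
      inner ℝ v₀ z - K.support v₀ - r / 2 * ‖v₀‖ ^ 2 + ‖e‖ ^ 2 / (2 * r) := by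
  refine csSup_le (Set.Nonempty.image _ ⟨v₀, hv₀⟩) ?_
  rintro _ ⟨v, hv, rfl⟩
  -- Since h_K(v) ≥ ⟨x, v⟩ with equality at v₀, the objective at v exceeds that at v₀ by at most ⟨v
  -- - v₀, z - x - r v₀⟩ - (r/2)|v - v₀|².
  have h1 := K.inner_le_support hx v
  have h2 := inner_sub_le_sq_div hr (v - v₀) e
  rw [← he v hv] at h2
  simp only [inner_sub_left, inner_sub_right, inner_smul_right, real_inner_self_eq_norm_sq,
    norm_sub_sq_real] at h2 ⊢
  rw [← hxv]
  rw [real_inner_comm x v, real_inner_comm x v₀] at *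
  linarith

/-- Testing the conjugate of L at v₀ bounds it below through h_L(v₀), while smoothness bounds that
of K above through h_K(v₀); the terms not involving the bodies cancel. -/
lemma support_le_of_regConjugate_le {D : Set E} {r τ : ℝ} (hr : 0 < r) (K L : ConvexBody E)
    {v₀ x z e : E} (hv₀ : v₀ ∈ D) (hx : x ∈ K) (hxv : inner ℝ x v₀ = K.support v₀)
    (he : ∀ v ∈ D, inner ℝ (v - v₀) (z - x - r • v₀) = inner ℝ (v - v₀) e)
    (hKL : regConjugate D r L z ≤ regConjugate D r K z + τ) :
    K.support v₀ ≤ L.support v₀ + (τ + ‖e‖ ^ 2 / (2 * r)) := by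
  have h1 := regConjugate_le_of_dual hr K hv₀ hx hxv he
  have h2 := le_regConjugate hr L z hv₀
  linarith

end ConvexBody

/-! ### Codes and their refinement -/

/-- A space is coded by `N` symbols at precision `η` if it splits into `N` classes
within each of which distances are at most `η`. -/
def IsCodedBy (X : Type*) [PseudoMetricSpace X] (η : ℝ) (N : ℕ) : Prop :=
  ∃ φ : X → Fin N, ∀ x y, φ x = φ y → dist x y ≤ η

lemma isCodedBy_of_fintype {X : Type*} [PseudoMetricSpace X] {η : ℝ} {ι : Type*} [Fintype ι]
    (φ : X → ι) (h : ∀ x y, φ x = φ y → dist x y ≤ η) : IsCodedBy X η (Fintype.card ι) :=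
  ⟨fun x => Fintype.equivFin ι (φ x), fun x y hxy => h x y ((Fintype.equivFin ι).injective hxy)⟩

/-- Refining a code: if finitely many real functionals vary by at most `Q τ` within each class of
the old code, then recording them up to `τ` costs a factor `2 Q + 1` for each functional. -/
lemma IsCodedBy.refine {X : Type*} [PseudoMetricSpace X] {η η' τ : ℝ} {N Q : ℕ}
    (hX : IsCodedBy X η N) {I : Type*} [Fintype I] (g : I → X → ℝ) (hτ : 0 < τ)
    (hg : ∀ x y, dist x y ≤ η → ∀ a, |g a x - g a y| ≤ Q * τ)
    (hg' : ∀ x y, (∀ a, |g a x - g a y| ≤ τ) → dist x y ≤ η') :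
    IsCodedBy X η' (N * (2 * Q + 1) ^ Fintype.card I) := by
  classical
  obtain ⟨φ, hφ⟩ := hX
  -- The representative depends only on the class, so within a class all functionals are measured
  -- from a common origin and only 2Q + 1 integer offsets can occur.
  let rep : X → X := fun x => Classical.choose (⟨x, rfl⟩ : ∃ y, φ y = φ x)
  have hrep : ∀ x, φ (rep x) = φ x := fun x =>
    Classical.choose_spec (⟨x, rfl⟩ : ∃ y, φ y = φ x)
  have hrep' : ∀ x y, φ x = φ y → rep x = rep y := by
    intro x y h
    simp only [rep, h]
  let q : X → I → ℤ := fun x a => ⌊(g a x - g a (rep x)) / τ⌋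
  have hq : ∀ x a, q x a ∈ Finset.Icc (-(Q : ℤ)) Q := by
    intro x a
    have h := abs_le.1 (hg x (rep x) (hφ _ _ (hrep x).symm) a)
    rw [Finset.mem_Icc]
    constructor
    · rw [Int.le_floor, le_div_iff₀ hτ]
      push_cast
      linarith [h.1]
    · have : ((q x a : ℤ) : ℝ) ≤ Q :=
        (Int.floor_le _).trans ((div_le_iff₀ hτ).2 h.2)
      exact_mod_cast this
  have key := isCodedBy_of_fintype (X := X) (η := η')
    (ι := Fin N × (I → Finset.Icc (-(Q : ℤ)) Q))
    (fun x => (φ x, fun a => ⟨q x a, hq x a⟩)) (by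
      intro x y hxy
      simp only [Prod.mk.injEq] at hxy
      obtain ⟨h1, h2⟩ := hxy
      refine hg' x y fun a => ?_
      have h3 : q x a = q y a := congrArg Subtype.val (congrFun h2 a)
      have h4 := Int.abs_sub_lt_one_of_floor_eq_floor h3
      rw [hrep' x y h1, ← sub_div, abs_div, abs_of_pos hτ, div_lt_one hτ] at h4
      rw [show g a x - g a y = g a x - g a (rep y) - (g a y - g a (rep y)) by ring]
      exact h4.le)
  have hcard : Fintype.card (Fin N × (I → Finset.Icc (-(Q : ℤ)) Q))
      = N * (2 * Q + 1) ^ Fintype.card I := by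
    rw [Fintype.card_prod, Fintype.card_fin, Fintype.card_fun, Fintype.card_coe, Int.card_Icc]
    congr 2
    omega
  rwa [hcard] at key

/-! ### Cube facets and grids of dual points -/

/-- The facet `v i = ±1` of the cube `[-1, 1]^(n+1)`. -/
def cubeFacet {n : ℕ} (i : Fin (n + 1)) (b : Bool) : Set (Euc (n + 1)) :=
  {v | v i = (if b then 1 else -1) ∧ ∀ j, |v j| ≤ 1}

lemma cubeFacet_nonempty {n : ℕ} (i : Fin (n + 1)) (b : Bool) : (cubeFacet i b).Nonempty := by
  refine ⟨WithLp.toLp 2 fun _ => if b then 1 else -1, rfl, fun j => ?_⟩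
  cases b <;> simp

lemma norm_sq_le_of_abs_le {d : ℕ} {c : ℝ} (v : Euc d) (h : ∀ j, |v j| ≤ c) :
    ‖v‖ ^ 2 ≤ d * c ^ 2 := by
  rw [EuclideanSpace.real_norm_sq_eq]
  calc ∑ j, v j ^ 2 ≤ ∑ _j : Fin d, c ^ 2 :=
        Finset.sum_le_sum fun j _ => sq_le_sq' (abs_le.1 (h j)).1 (abs_le.1 (h j)).2
    _ = d * c ^ 2 := by simp

lemma norm_le_of_mem_cubeFacet {n : ℕ} {i : Fin (n + 1)} {b : Bool} {v : Euc (n + 1)}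
    (hv : v ∈ cubeFacet i b) : ‖v‖ ≤ (n + 1 : ℕ) := by
  have h := norm_sq_le_of_abs_le v hv.2
  have h1 : (1 : ℝ) ≤ (n + 1 : ℕ) := by push_cast; linarith [Nat.cast_nonneg (α := ℝ) n]
  nlinarith [norm_nonneg v]

lemma abs_apply_le_norm {d : ℕ} (x : Euc d) (j : Fin d) : |x j| ≤ ‖x‖ := by
  simpa using PiLp.norm_apply_le x j

/-- Divide by the largest coordinate in absolute value. Having t ≤ 1 means that, by homogeneity,
bounds on support functions over the facets pass to the sphere without loss. -/
lemma exists_smul_mem_cubeFacet {n : ℕ} {w : Euc (n + 1)} (hw : ‖w‖ = 1) :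
    ∃ i b, ∃ t : ℝ, 0 ≤ t ∧ t ≤ 1 ∧ ∃ v ∈ cubeFacet i b, w = t • v := by
  obtain ⟨i, hi⟩ := Finite.exists_max fun j => |w j|
  have hpos : 0 < |w i| := by
    by_contra hcon
    have h0 : w = 0 := by
      ext j
      have := (hi j).trans (not_lt.1 hcon)
      simpa using this
    simp [h0] at hw
  refine ⟨i, decide (0 < w i), |w i|, hpos.le, hw ▸ abs_apply_le_norm w i, |w i|⁻¹ • w,
    ⟨?_, fun j => ?_⟩, ?_⟩
  · rw [PiLp.smul_apply, smul_eq_mul]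
    rcases lt_or_gt_of_ne (abs_pos.1 hpos) with h | h
    · have : ¬ 0 < w i := by linarith
      rw [abs_of_neg h]
      simp only [this, decide_false, Bool.false_eq_true, if_false]
      rw [inv_neg, neg_mul, inv_mul_cancel₀ h.ne]
    · rw [abs_of_pos h]
      simp only [h, decide_true, if_true]
      field_simp
  · rw [PiLp.smul_apply, smul_eq_mul, abs_mul, abs_inv, abs_abs]
    exact (inv_mul_le_one₀ hpos).2 (hi j)
  · rw [smul_smul, mul_inv_cancel₀ hpos.ne', one_smul]

/-- The grid of spacing `t` and side `2 m + 1` in the coordinate hyperplane `y i = 0`. -/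
def gridPoint {n : ℕ} (i : Fin (n + 1)) (t : ℝ) (m : ℕ) (k : Fin n → Fin (2 * m + 1)) :
    Euc (n + 1) :=
  WithLp.toLp 2 (i.insertNth (0 : ℝ) fun j => t * (((k j : ℕ) : ℝ) - m))

lemma exists_grid_index {t : ℝ} (ht : 0 < t) {m : ℕ} {a : ℝ} (ha : |a| ≤ t * m) :
    ∃ k : Fin (2 * m + 1), |t * (((k : ℕ) : ℝ) - m) - a| ≤ t := by
  obtain ⟨h1, h2⟩ := abs_le.1 ha
  have h3 : 0 ≤ a / t + m := by
    have : -(m : ℝ) ≤ a / t := by rw [le_div_iff₀ ht]; linarith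
    linarith
  have h4 : a / t + m ≤ 2 * m := by
    have : a / t ≤ m := by rw [div_le_iff₀ ht]; linarith
    linarith
  have h5 : ⌊a / t + m⌋₊ < 2 * m + 1 := by
    rw [Nat.lt_succ_iff]
    exact_mod_cast (Nat.floor_le h3).trans h4
  refine ⟨⟨_, h5⟩, ?_⟩
  have h6 := Nat.floor_le h3
  have h7 := Nat.lt_floor_add_one (a / t + m)
  have h8 : a = t * (a / t) := by field_simp
  rw [show t * (((⌊a / t + m⌋₊ : ℕ) : ℝ) - m) - a
    = t * ((⌊a / t + m⌋₊ : ℝ) - m - a / t) by rw [mul_sub t _ (a / t), ← h8], abs_mul,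
    abs_of_pos ht]
  refine mul_le_of_le_one_right ht.le (abs_le.2 ⟨by linarith, by linarith⟩)

/-- Two convex bodies whose regularized conjugates agree up to `τ` on the grids are close. -/
lemma dist_le_of_regConjugate_gridPoint {n : ℕ} {r t τ : ℝ} (hr : 0 < r) (ht : 0 < t)
    (hτ : 0 ≤ τ) {m : ℕ} (hm : 2 * r ≤ t * m) {K L : ConvexBody (Euc (n + 1))}
    (hK : (K : Set (Euc (n + 1))) ⊆ closedBall 0 r) (hL : (L : Set (Euc (n + 1))) ⊆ closedBall 0 r)
    (h : ∀ i b k, |ConvexBody.regConjugate (cubeFacet i b) r K (gridPoint i t m k) -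
      ConvexBody.regConjugate (cubeFacet i b) r L (gridPoint i t m k)| ≤ τ) :
    dist K L ≤ τ + (n + 1 : ℕ) * t ^ 2 / (2 * r) := by
  have main : ∀ {K L : ConvexBody (Euc (n + 1))}, (K : Set (Euc (n + 1))) ⊆ closedBall 0 r →
      (∀ i b k, ConvexBody.regConjugate (cubeFacet i b) r L (gridPoint i t m k) ≤
        ConvexBody.regConjugate (cubeFacet i b) r K (gridPoint i t m k) + τ) →
      ∀ i b, ∀ v ∈ cubeFacet i b,
        K.support v ≤ L.support v + (τ + (n + 1 : ℕ) * t ^ 2 / (2 * r)) := by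
    intro K L hK h i b v₀ hv₀
    obtain ⟨x, hx, hxv⟩ := K.exists_inner_eq_support v₀
    have ha : ∀ j, |(x + r • v₀) j| ≤ t * m := by
      intro j
      have h1 : |x j| ≤ r := (abs_apply_le_norm x j).trans (mem_closedBall_zero_iff.1 (hK hx))
      have h2 : |r * v₀ j| ≤ r := by
        rw [abs_mul, abs_of_pos hr]
        exact mul_le_of_le_one_right hr.le (hv₀.2 j)
      rw [PiLp.add_apply, PiLp.smul_apply, smul_eq_mul]
      linarith [abs_add_le (x j) (r * v₀ j)]
    -- The grid point is matched to the dual point x + r v₀ in every coordinate except the i-th.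
    choose k hk using fun j : Fin n => exists_grid_index ht (ha (i.succAbove j))
    let z := gridPoint i t m k
    -- The i-th coordinate of the error may be discarded because v - v₀ vanishes there for v in the
    -- facet. This is what makes the exponent n/2 and not (n + 1)/2.
    let e : Euc (n + 1) := WithLp.toLp 2 (i.insertNth (0 : ℝ)
      fun j => (z - x - r • v₀) (i.succAbove j))
    have he : ∀ v ∈ cubeFacet i b, inner ℝ (v - v₀) (z - x - r • v₀) = inner ℝ (v - v₀) e := by
      intro v hv
      rw [PiLp.inner_apply, PiLp.inner_apply, Fin.sum_univ_succAbove _ i,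
        Fin.sum_univ_succAbove _ i]
      have h0 : (v - v₀) i = 0 := by rw [PiLp.sub_apply, hv.1, hv₀.1, sub_self]
      rw [h0]
      simp [e]
    have hen : ‖e‖ ^ 2 ≤ (n + 1 : ℕ) * t ^ 2 := by
      apply norm_sq_le_of_abs_le
      intro j
      induction j using Fin.succAboveCases i with
      | x => simpa [e] using ht.le
      | p j =>
        have := hk j
        simp only [PiLp.add_apply] at this
        simpa [e, z, gridPoint, sub_sub] using this
    refine (ConvexBody.support_le_of_regConjugate_le hr K L hv₀ hx hxv he (h i b k)).trans ?_
    gcongr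
  have hη : 0 ≤ τ + (n + 1 : ℕ) * t ^ 2 / (2 * r) := by positivity
  refine K.dist_le_of_abs_support_sub_le L hη fun w hw => ?_
  obtain ⟨i, b, s, hs0, hs1, v, hv, rfl⟩ := exists_smul_mem_cubeFacet hw
  rw [K.support_smul hs0, L.support_smul hs0, ← mul_sub, abs_mul, abs_of_nonneg hs0]
  have h1 := main (K := K) (L := L) hK (fun i b k => by linarith [(abs_le.1 (h i b k)).1]) i b v hv
  have h2 := main (K := L) (L := K) hL (fun i b k => by linarith [(abs_le.1 (h i b k)).2]) i b v hv
  calc s * |K.support v - L.support v| ≤ 1 * |K.support v - L.support v| := by gcongr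
    _ ≤ _ := by rw [one_mul]; exact abs_le.2 ⟨by linarith, by linarith⟩

/-! ### Multiscale coding of the bodies in a ball -/

/-- The convex bodies contained in the closed ball of radius `r`. -/
abbrev BodiesInBall (d : ℕ) (r : ℝ) : Type :=
  {K : ConvexBody (Euc d) // (K : Set (Euc d)) ⊆ closedBall 0 r}

lemma dist_zero_le_of_subset_closedBall {d : ℕ} {r : ℝ} (hr : 0 ≤ r) {K : ConvexBody (Euc d)}
    (hK : (K : Set (Euc d)) ⊆ closedBall 0 r) : dist K 0 ≤ r :=
  K.dist_le_of_abs_support_sub_le 0 hr fun w hw => by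
    have h0 : (0 : ConvexBody (Euc d)).support w = 0 := by
      simp [ConvexBody.support]
    simpa [h0, hw] using K.abs_support_le hK w

/-- With η = 2r/4^j, half of the new precision η/4 goes to the rounding τ = η/8 and half to the grid
error, which is (n + 1)/n² · η/16 ≤ η/8. The choice of m gives t m = 2r, enough to reach every
coordinate of x + r v₀. Facet vectors have norm at most n + 1, so values vary by at most (n + 1)η =
8(n + 1)τ within a class. -/
lemma IsCodedBy.refine_bodiesInBall {n : ℕ} (hn : 1 ≤ n) {r : ℝ} (hr : 0 < r) (j N : ℕ)
    (h : IsCodedBy (BodiesInBall (n + 1) r) (2 * r / 4 ^ j) N) :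
    IsCodedBy (BodiesInBall (n + 1) r) (2 * r / 4 ^ (j + 1))
      (N * (2 * (8 * (n + 1)) + 1) ^ (2 * (n + 1) * (2 * (4 * n * 2 ^ j) + 1) ^ n)) := by
  have hn' : (1 : ℝ) ≤ n := by exact_mod_cast hn
  set t : ℝ := r / (2 * n * 2 ^ j) with ht
  have htpos : 0 < t := by positivity
  set m : ℕ := 4 * n * 2 ^ j with hm
  have htm : 2 * r ≤ t * m := by
    rw [ht, hm]
    push_cast
    apply le_of_eq
    field_simp
    norm_num
  set τ : ℝ := 2 * r / 4 ^ j / 8 with hτ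
  have hτpos : 0 < τ := by positivity
  have key := h.refine (η' := 2 * r / 4 ^ (j + 1)) (Q := 8 * (n + 1))
    (I := Fin (n + 1) × Bool × (Fin n → Fin (2 * m + 1)))
    (fun a K => ConvexBody.regConjugate (cubeFacet a.1 a.2.1) r K.1 (gridPoint a.1 t m a.2.2))
    hτpos ?_ ?_
  · convert key using 3
    simp
    ring
  · rintro K L hKL ⟨i, b, k⟩
    have h1 := ConvexBody.regConjugate_le_add (cubeFacet_nonempty i b) hr
      (fun v hv => norm_le_of_mem_cubeFacet hv) K.1 L.1 (gridPoint i t m k)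
    have h2 := ConvexBody.regConjugate_le_add (cubeFacet_nonempty i b) hr
      (fun v hv => norm_le_of_mem_cubeFacet hv) L.1 K.1 (gridPoint i t m k)
    rw [dist_comm L.1 K.1] at h2
    have h3 : ((n + 1 : ℕ) : ℝ) * dist K.1 L.1 ≤ (8 * (n + 1) : ℕ) * τ := by
      have : ((8 * (n + 1) : ℕ) : ℝ) * τ = (n + 1 : ℕ) * (2 * r / 4 ^ j) := by
        rw [hτ]; push_cast; ring
      rw [this]
      exact mul_le_mul_of_nonneg_left hKL (by positivity)
    exact abs_le.2 ⟨by linarith, by linarith⟩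
  · intro K L hKL
    refine (dist_le_of_regConjugate_gridPoint hr htpos hτpos.le htm K.2 L.2
      fun i b k => hKL (i, b, k)).trans ?_
    have h4 : ((2 : ℝ) ^ j) ^ 2 = 4 ^ j := by rw [← pow_mul, mul_comm, pow_mul]; norm_num
    have h1 : ((n + 1 : ℕ) : ℝ) * t ^ 2 / (2 * r) = (n + 1) / n ^ 2 * (r / 4 ^ j / 8) := by
      rw [ht, div_pow, mul_pow, h4]
      push_cast
      field_simp
      norm_num
    have h2 : ((n : ℝ) + 1) / n ^ 2 ≤ 2 := by
      rw [div_le_iff₀ (by positivity)]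
      nlinarith
    have h3 : ((n : ℝ) + 1) / n ^ 2 * (r / 4 ^ j / 8) ≤ 2 * (r / 4 ^ j / 8) := by gcongr
    have h5 : 2 * r / 4 ^ (j + 1) = 2 * r / 4 ^ j / 8 + 2 * (r / 4 ^ j / 8) := by
      rw [pow_succ]
      field_simp
      norm_num
    rw [h1, hτ, h5]
    linarith

/-- A constant such that the bodies in a ball of radius `r` in dimension `n + 1` are coded at
precision `2 r / 4 ^ j` by `exp (C 2 ^ (n j))` symbols. -/
def codeConst (n : ℕ) : ℝ :=
  Real.log (2 * (8 * (n + 1)) + 1) * (2 * (n + 1) * (9 * n) ^ n)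

lemma exists_isCodedBy_bodiesInBall {n : ℕ} (hn : 1 ≤ n) {r : ℝ} (hr : 0 < r) (j : ℕ) :
    ∃ N : ℕ, 0 < N ∧ Real.log N ≤ codeConst n * (2 ^ j) ^ n ∧
      IsCodedBy (BodiesInBall (n + 1) r) (2 * r / 4 ^ j) N := by
  have hn' : (1 : ℝ) ≤ n := by exact_mod_cast hn
  have hlog : 0 ≤ Real.log (2 * (8 * ((n : ℝ) + 1)) + 1) := Real.log_nonneg (by linarith)
  have hC : 0 ≤ codeConst n := by unfold codeConst; positivity
  induction j with
  | zero =>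
    -- At precision 2r a single class suffices, as every body is within r of {0}.
    refine ⟨1, one_pos, by simpa using hC, fun _ => 0, fun K L _ => ?_⟩
    have h1 := dist_zero_le_of_subset_closedBall hr.le K.2
    have h2 := dist_zero_le_of_subset_closedBall hr.le L.2
    have h3 := dist_triangle_right K.1 L.1 0
    have h4 : dist K L = dist K.1 L.1 := rfl
    rw [h4, pow_zero, div_one]
    linarith
  | succ j ih =>
    obtain ⟨N, hN, hlogN, hcode⟩ := ih
    refine ⟨_, by positivity, ?_, hcode.refine_bodiesInBall hn hr⟩
    push_cast
    rw [Real.log_mul (by positivity) (by positivity), Real.log_pow]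
    have h2j : (1 : ℝ) ≤ 2 ^ j := one_le_pow₀ (by norm_num)
    have h1 : (2 * (4 * (n : ℝ) * 2 ^ j) + 1) ^ n ≤ (9 * n) ^ n * (2 ^ j) ^ n := by
      rw [← mul_pow]
      gcongr
      nlinarith
    have h2 : ((2 * (n + 1) * (2 * (4 * n * 2 ^ j) + 1) ^ n : ℕ) : ℝ) *
        Real.log (2 * (8 * ((n : ℝ) + 1)) + 1) ≤ codeConst n * (2 ^ j) ^ n := by
      unfold codeConst
      push_cast
      calc 2 * ((n : ℝ) + 1) * (2 * (4 * n * 2 ^ j) + 1) ^ n *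
            Real.log (2 * (8 * ((n : ℝ) + 1)) + 1)
          ≤ 2 * ((n : ℝ) + 1) * ((9 * n) ^ n * (2 ^ j) ^ n) *
            Real.log (2 * (8 * ((n : ℝ) + 1)) + 1) := by gcongr
        _ = _ := by ring
    -- The inherited cost and the new cost are each at most C 2^(jn); since n ≥ 1, their sum fits in
    -- the bound for the next scale.
    have h3 : (2 : ℝ) * (2 ^ j) ^ n ≤ (2 ^ (j + 1)) ^ n := by
      rw [pow_succ, mul_pow, mul_comm]
      gcongr
      exact le_self_pow₀ (by norm_num) (by omega)
    nlinarith [mul_le_mul_of_nonneg_left h3 hC]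

/-! ### From codes to metric entropy -/

lemma IsCodedBy.externalCoveringNumber_le {X : Type*} [PseudoMetricSpace X] {A : Set X} {N : ℕ}
    {ε : ℝ≥0} (h : IsCodedBy A ε N) : externalCoveringNumber ε A ≤ N := by
  obtain ⟨φ, hφ⟩ := h
  choose ψ hψ using fun c : Set.range φ => c.2
  have hcover : IsCover ε A (Set.range fun c => (ψ c : X)) := by
    intro x hx
    refine ⟨_, ⟨⟨φ ⟨x, hx⟩, Set.mem_range_self _⟩, rfl⟩, ?_⟩
    have h1 := hφ ⟨x, hx⟩ _ (hψ ⟨φ ⟨x, hx⟩, Set.mem_range_self _⟩).symm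
    rw [Subtype.dist_eq] at h1
    simp only [Set.mem_ofPred_eq, edist_dist]
    exact ENNReal.ofReal_le_of_le_toReal (by simpa using h1)
  refine hcover.externalCoveringNumber_le_encard.trans ?_
  rw [← Set.image_univ]
  refine (Set.encard_image_le _ _).trans ?_
  rw [Set.encard_univ, ENat.card_coe_set_eq]
  refine (Set.encard_le_encard (Set.subset_univ _)).trans ?_
  simp

lemma metricEntropy_le_of_externalCoveringNumber_le {X : Type*} [PseudoEMetricSpace X] {A : Set X}
    {ε : ℝ≥0} {N : ℕ} {c : ℝ} (hN : 0 < N) (h : externalCoveringNumber ε A ≤ N)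
    (hc : Real.log N ≤ c) : metricEntropy A ε ≤ (c : EReal) := by
  have h1 : ((externalCoveringNumber ε A : ℕ∞) : ℝ≥0∞) ≤ ENNReal.ofReal N := by
    rw [ENNReal.ofReal_natCast]
    exact_mod_cast h
  refine (ENNReal.log_le_log h1).trans ?_
  rw [ENNReal.log_ofReal_of_pos (by exact_mod_cast hN)]
  exact_mod_cast hc

lemma metricEntropy_subset_closedBall_le {n : ℕ} (hn : 1 ≤ n) {r : ℝ} (hr : 0 < r) {ε : ℝ≥0}
    (hε : 0 < ε) :
    metricEntropy {K : ConvexBody (Euc (n + 1)) | (K : Set (Euc (n + 1))) ⊆ closedBall 0 r} ε ≤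
      ((codeConst n * 4 ^ n * (r / ε) ^ ((n : ℝ) / 2) : ℝ) : EReal) := by
  have hε' : (0 : ℝ) < ε := hε
  have hn' : (1 : ℝ) ≤ n := by exact_mod_cast hn
  have hlog : 0 ≤ Real.log (2 * (8 * ((n : ℝ) + 1)) + 1) := Real.log_nonneg (by linarith)
  have hC : 0 ≤ codeConst n := by unfold codeConst; positivity
  rcases le_or_gt r ε with hrε | hrε
  · have hcover : IsCover ε {K : ConvexBody (Euc (n + 1)) |
        (K : Set (Euc (n + 1))) ⊆ closedBall 0 r} {0} := by
      intro K hK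
      refine ⟨0, rfl, ?_⟩
      have := (dist_zero_le_of_subset_closedBall hr.le hK).trans hrε
      simp only [Set.mem_ofPred_eq, edist_dist]
      exact ENNReal.ofReal_le_of_le_toReal (by simpa using this)
    refine metricEntropy_le_of_externalCoveringNumber_le one_pos
      (hcover.externalCoveringNumber_le_encard.trans (by simp)) ?_
    rw [Nat.cast_one, Real.log_one]
    positivity
  -- Choose 4^k ≤ 2r/ε < 4^(k+1): level k + 1 is fine enough, and 2^(k+1) is still at most 4√(r/ε).
  · obtain ⟨k, hk1, hk2⟩ := exists_nat_pow_near (x := 2 * r / ε) (y := (4 : ℝ))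
      (by rw [le_div_iff₀ hε']; linarith) (by norm_num)
    obtain ⟨N, hN, hlogN, hcode⟩ := exists_isCodedBy_bodiesInBall hn hr (k + 1)
    have hprec : 2 * r / 4 ^ (k + 1) ≤ ε := by
      rw [div_lt_iff₀ hε'] at hk2
      rw [div_le_iff₀ (by positivity)]
      linarith
    obtain ⟨φ, hφ⟩ := hcode
    have hcode' : IsCodedBy {K : ConvexBody (Euc (n + 1)) |
        (K : Set (Euc (n + 1))) ⊆ closedBall 0 r} ε N :=
      ⟨φ, fun x y hxy => (hφ x y hxy).trans hprec⟩
    refine metricEntropy_le_of_externalCoveringNumber_le hN hcode'.externalCoveringNumber_le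
      (hlogN.trans ?_)
    rw [mul_assoc]
    refine mul_le_mul_of_nonneg_left ?_ hC
    have h1 : (2 : ℝ) ^ (k + 1) ≤ 4 * √(r / ε) := by
      have : (2 : ℝ) ^ k ≤ 2 * √(r / ε) := by
        apply le_of_sq_le_sq _ (by positivity)
        rw [mul_pow, Real.sq_sqrt (by positivity), ← pow_mul, mul_comm k, pow_mul]
        have : 2 * r / ε ≤ 2 ^ 2 * (r / ε) := by
          rw [mul_div_assoc]
          gcongr
          norm_num
        norm_num at this ⊢
        linarith
      rw [pow_succ]
      linarith
    calc ((2 : ℝ) ^ (k + 1)) ^ n ≤ (4 * √(r / ε)) ^ n := by gcongr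
      _ = 4 ^ n * (r / ε) ^ ((n : ℝ) / 2) := by
        rw [mul_pow, Real.sqrt_eq_rpow, ← Real.rpow_mul_natCast (by positivity)]
        congr 2
        ring

/-! ### Reduction of the class to a ball -/

lemma exists_le_uniformSphere_ball (d : ℕ) (hd : 0 < d) :
    ∃ a : ℝ, 0 < a ∧ a ≤ 1 ∧
      ∀ w : sphere (0 : Euc d) 1, ENNReal.ofReal a ≤ uniformSphere d (ball w 1) := by
  have : Nonempty (Fin d) := ⟨⟨0, hd⟩⟩
  set σ := (volume : Measure (Euc d)).toSphere with hσ
  set b : ℝ≥0∞ := (σ Set.univ)⁻¹ *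
    (Measure.toSphereBallBound (Module.finrank ℝ (Euc d)) 1 *
      (volume : Measure (Euc d)) (ball 0 1)) with hb
  have hσ0 : σ Set.univ ≠ 0 := by
    rw [Ne, Measure.measure_univ_eq_zero]
    exact Measure.toSphere_ne_zero _
  have hb0 : b ≠ 0 := by
    refine mul_ne_zero (ENNReal.inv_ne_zero.2 (measure_ne_top _ _)) (mul_ne_zero ?_ ?_)
    · exact_mod_cast (Measure.toSphereBallBound_pos _ _).ne'
    · exact (measure_ball_pos _ _ one_pos).ne'
  have hbt : b ≠ ⊤ :=
    ENNReal.mul_ne_top (ENNReal.inv_ne_top.2 hσ0)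
      (ENNReal.mul_ne_top ENNReal.coe_ne_top measure_ball_lt_top.ne)
  refine ⟨min b.toReal 1, lt_min (ENNReal.toReal_pos hb0 hbt) one_pos, min_le_right _ _,
    fun w => ?_⟩
  calc ENNReal.ofReal (min b.toReal 1) ≤ ENNReal.ofReal b.toReal :=
        ENNReal.ofReal_le_ofReal (min_le_left _ _)
    _ = b := ENNReal.ofReal_toReal hbt
    _ ≤ uniformSphere d (ball w 1) := by
      rw [uniformSphere, Measure.smul_apply, smul_eq_mul, hb]
      gcongr
      exact Measure.toSphereBallBound_mul_measure_unitBall_le_toSphere_ball _ one_pos w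

/-- Unit vectors at distance less than 1 make an angle below 60°, whose cosine exceeds 1/2. -/
lemma half_norm_le_inner_of_dist_lt_one {d : ℕ} {x u : Euc d} (hx : x ≠ 0) (hu : ‖u‖ = 1)
    (h : ‖u - (‖x‖⁻¹ : ℝ) • x‖ < 1) : ‖x‖ / 2 ≤ inner ℝ x u := by
  have hpos : 0 < ‖x‖ := norm_pos_iff.2 hx
  have hw : ‖(‖x‖⁻¹ : ℝ) • x‖ = 1 := by
    rw [norm_smul, norm_inv, norm_norm, inv_mul_cancel₀ hpos.ne']
  have h1 := norm_sub_sq_real u ((‖x‖⁻¹ : ℝ) • x)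
  rw [hw, hu, inner_smul_right, real_inner_comm] at h1
  have h2 : ‖u - (‖x‖⁻¹ : ℝ) • x‖ ^ 2 < 1 := by
    nlinarith [norm_nonneg (u - (‖x‖⁻¹ : ℝ) • x)]
  have h3 : 1 / 2 ≤ ‖x‖⁻¹ * inner ℝ x u := by linarith
  rw [inv_mul_eq_div, le_div_iff₀ hpos] at h3
  linarith

lemma exists_subset_closedBall_of_mem_convexClass (d : ℕ) (hd : 0 < d) :
    ∃ C : ℝ, 0 < C ∧ ∀ (p : ℝ≥0∞) (R : ℝ), 1 ≤ p → 0 < R →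
      ∀ K ∈ convexClass d p R, (K : Set (Euc d)) ⊆ closedBall 0 (C * R) := by
  obtain ⟨a, ha0, ha1, ha⟩ := exists_le_uniformSphere_ball d hd
  refine ⟨2 / a, by positivity, fun p R hp hR K hK x hx => ?_⟩
  rw [mem_closedBall_zero_iff]
  by_cases hx0 : x = 0
  · rw [hx0, norm_zero]; positivity
  have hpos : 0 < ‖x‖ := norm_pos_iff.2 hx0
  let w : sphere (0 : Euc d) 1 := ⟨(‖x‖⁻¹ : ℝ) • x, by
    rw [mem_sphere_zero_iff_norm, norm_smul, norm_inv, norm_norm, inv_mul_cancel₀ hpos.ne']⟩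
  have hsupp : ∀ u ∈ ball w 1, ‖x‖ / 2 ≤ |supportFn K u| := by
    intro u hu
    rw [mem_ball, Subtype.dist_eq, dist_eq_norm] at hu
    exact (half_norm_le_inner_of_dist_lt_one hx0 (mem_sphere_zero_iff_norm.1 u.2) hu).trans
      ((K.inner_le_support hx u).trans (le_abs_self _))
  suffices h : a * (‖x‖ / 2) ≤ R by
    rw [div_mul_eq_mul_div, le_div_iff₀ ha0]
    linarith
  by_cases hpt : p = ∞
  · have h1 := (hsupp w (mem_ball_self one_pos)).trans (hK.1 hpt w)
    exact (mul_le_of_le_one_left (by positivity) ha1).trans h1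
  · have hp1 : 1 ≤ p.toReal := by
      rw [← ENNReal.toReal_one]
      exact ENNReal.toReal_mono hpt hp
    have h1 : ENNReal.ofReal ((‖x‖ / 2) ^ p.toReal) * ENNReal.ofReal a
        ≤ ENNReal.ofReal (R ^ p.toReal) := by
      calc _ ≤ ENNReal.ofReal ((‖x‖ / 2) ^ p.toReal) * uniformSphere d (ball w 1) := by
            gcongr
            exact ha w
        _ = ∫⁻ _u in ball w 1, ENNReal.ofReal ((‖x‖ / 2) ^ p.toReal) ∂uniformSphere d := by
            rw [setLIntegral_const]
        _ ≤ ∫⁻ u in ball w 1, ENNReal.ofReal (|supportFn K u| ^ p.toReal) ∂uniformSphere d := by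
            refine setLIntegral_mono' measurableSet_ball fun u hu => ?_
            exact ENNReal.ofReal_le_ofReal
              (Real.rpow_le_rpow (by positivity) (hsupp u hu) (by linarith))
        _ ≤ _ := setLIntegral_le_lintegral _ _
        _ ≤ _ := hK.2 hpt
    rw [← ENNReal.ofReal_mul (by positivity), ENNReal.ofReal_le_ofReal_iff (by positivity)] at h1
    -- As a ≤ 1 ≤ p, the cap measure a can be replaced by a^p; taking p-th roots then leaves a
    -- constant independent of p.
    have h2 : a ^ p.toReal ≤ a := by
      simpa using Real.rpow_le_rpow_of_exponent_ge ha0 ha1 hp1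
    have h3 : (a * (‖x‖ / 2)) ^ p.toReal ≤ R ^ p.toReal := by
      rw [Real.mul_rpow ha0.le (by positivity), mul_comm]
      exact (mul_le_mul_of_nonneg_left h2 (by positivity)).trans h1
    exact (Real.rpow_le_rpow_iff (by positivity) hR.le (by linarith)).1 h3

/-! ### Lower bound: separated families of hulls -/

lemma mem_convexClass_of_subset_closedBall {d : ℕ} {p : ℝ≥0∞} {R : ℝ} {K : ConvexBody (Euc d)}
    (hK : (K : Set (Euc d)) ⊆ closedBall 0 R) : K ∈ convexClass d p R := by
  have hsupp : ∀ u, |supportFn K u| ≤ R := fun u => by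
    have := K.abs_support_le hK (u : Euc d)
    rwa [mem_sphere_zero_iff_norm.1 u.2, mul_one] at this
  refine ⟨fun _ => hsupp, fun _ => ?_⟩
  calc ∫⁻ u, ENNReal.ofReal (|supportFn K u| ^ p.toReal) ∂uniformSphere d
      ≤ ∫⁻ _u, ENNReal.ofReal (R ^ p.toReal) ∂uniformSphere d :=
        lintegral_mono fun u => ENNReal.ofReal_le_ofReal
          (Real.rpow_le_rpow (abs_nonneg _) (hsupp u) ENNReal.toReal_nonneg)
    _ = ENNReal.ofReal (R ^ p.toReal) * uniformSphere d Set.univ := by rw [lintegral_const]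
    _ ≤ ENNReal.ofReal (R ^ p.toReal) * 1 := by
        gcongr
        rw [uniformSphere, Measure.smul_apply, smul_eq_mul]
        exact ENNReal.inv_mul_le_one _
    _ = _ := mul_one _

/-- Two points more than 2ε apart cannot share a closed ε-ball, wherever its center lies. -/
lemma card_le_externalCoveringNumber_of_dist {X ι : Type*} [PseudoMetricSpace X] [Fintype ι]
    {A : Set X} {ε : ℝ≥0} (f : ι → X) (hA : ∀ i, f i ∈ A)
    (hf : ∀ i j, i ≠ j → 2 * (ε : ℝ) < dist (f i) (f j)) :
    (Fintype.card ι : ℕ∞) ≤ externalCoveringNumber ε A := by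
  have hinj : Function.Injective f := by
    intro i j hij
    by_contra hne
    have := hf i j hne
    rw [hij, dist_self] at this
    linarith [ε.coe_nonneg]
  have hsep : IsSeparated ((2 * ε : ℝ≥0) : ℝ≥0∞) (Set.range f) := by
    rintro _ ⟨i, rfl⟩ _ ⟨j, rfl⟩ hne
    have := hf i j fun h => hne (h ▸ rfl)
    rw [edist_nndist, ENNReal.coe_lt_coe, ← NNReal.coe_lt_coe]
    exact_mod_cast this
  have h1 := hsep.encard_le_packingNumber (A := A) (Set.range_subset_iff.2 hA)
  have h2 : (Set.range f).encard = Fintype.card ι := by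
    rw [← Set.image_univ, hinj.encard_image, Set.encard_univ, ENat.card_eq_coe_fintype_card]
  rw [← h2]
  exact h1.trans (packingNumber_two_mul_le_externalCoveringNumber ε A)

lemma le_metricEntropy_of_le_externalCoveringNumber {X : Type*} [PseudoEMetricSpace X] {A : Set X}
    {ε : ℝ≥0} {N : ℕ} {c : ℝ} (hN : 0 < N) (h : (N : ℕ∞) ≤ externalCoveringNumber ε A)
    (hc : c ≤ Real.log N) : (c : EReal) ≤ metricEntropy A ε := by
  have h1 : ENNReal.ofReal N ≤ ((externalCoveringNumber ε A : ℕ∞) : ℝ≥0∞) := by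
    rw [ENNReal.ofReal_natCast]
    exact_mod_cast h
  refine le_trans ?_ (ENNReal.log_le_log h1)
  rw [ENNReal.log_ofReal_of_pos (by exact_mod_cast hN)]
  exact_mod_cast hc

/-- The convex hull of the origin and of finitely many points. -/
def hullWithZero {d : ℕ} {ι : Type*} (x : ι → Euc d) (S : Finset ι) : ConvexBody (Euc d) where
  -- Adjoining the origin keeps the hull nonempty for the empty index set, so every subset counts.
  carrier := convexHull ℝ (insert 0 (x '' S))
  convex' := convex_convexHull ℝ _
  isCompact' := ((S.finite_toSet.image x).insert 0).isCompact_convexHull ℝ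
  nonempty' := ⟨0, subset_convexHull ℝ _ (Set.mem_insert _ _)⟩

lemma hullWithZero_subset_closedBall {d : ℕ} {ι : Type*} {x : ι → Euc d} {R : ℝ} (hR : 0 ≤ R)
    (hx : ∀ i, ‖x i‖ ≤ R) (S : Finset ι) :
    (hullWithZero x S : Set (Euc d)) ⊆ closedBall 0 R := by
  refine convexHull_min (Set.insert_subset (by simpa using hR) ?_) (convex_closedBall _ _)
  rintro _ ⟨i, -, rfl⟩
  simpa using hx i

lemma mem_hullWithZero {d : ℕ} {ι : Type*} (x : ι → Euc d) {S : Finset ι} {i : ι} (hi : i ∈ S) :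
    x i ∈ hullWithZero x S :=
  subset_convexHull ℝ _ (Set.mem_insert_of_mem _ ⟨i, hi, rfl⟩)

lemma support_hullWithZero_le {d : ℕ} {ι : Type*} {x : ι → Euc d} {S : Finset ι} {v : Euc d}
    {c : ℝ} (hc : 0 ≤ c) (h : ∀ i ∈ S, inner ℝ (x i) v ≤ c) :
    (hullWithZero x S).support v ≤ c := by
  refine ConvexBody.support_le _ fun y hy => ?_
  have hconv : Convex ℝ {y : Euc d | inner ℝ y v ≤ c} :=
    convex_halfSpace_le ⟨fun _ _ => inner_add_left _ _ _, fun _ _ => by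
      simp [inner_smul_left]⟩ c
  refine convexHull_min (Set.insert_subset (by simpa using hc) ?_) hconv hy
  rintro _ ⟨i, hi, rfl⟩
  exact h i hi

/-- If i lies in S but not in T, the support functions in direction x_i are at least R for S and at
most R(1 - θ) for T. The origin obeys the latter bound because θ ≤ 1. -/
lemma mul_le_dist_hullWithZero {d : ℕ} {ι : Type*} {x : ι → Euc d} {R θ : ℝ}
    (hR : 0 < R) (hθ : θ ≤ 1) (hx : ∀ i, ‖x i‖ = 1)
    (hxx : ∀ i j, i ≠ j → inner ℝ (x i) (x j) ≤ 1 - θ) {S T : Finset ι} (hST : S ≠ T) :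
    R * θ ≤ dist (hullWithZero (fun i => R • x i) S) (hullWithZero (fun i => R • x i) T) := by
  have main : ∀ (S T : Finset ι) (i : ι), i ∈ S → i ∉ T →
      R * θ ≤ dist (hullWithZero (fun i => R • x i) S) (hullWithZero (fun i => R • x i) T) := by
    intro S T i hS hT
    have h1 := ConvexBody.inner_le_support _ (mem_hullWithZero (fun i => R • x i) hS) (x i)
    have h2 : (hullWithZero (fun i => R • x i) T).support (x i) ≤ R * (1 - θ) := by
      refine support_hullWithZero_le (mul_nonneg hR.le (by linarith)) fun j hj => ?_
      rw [real_inner_smul_left]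
      exact mul_le_mul_of_nonneg_left (hxx j i (fun h => hT (h ▸ hj))) hR.le
    have h3 := ConvexBody.support_le_support_add (hullWithZero (fun i => R • x i) S)
      (hullWithZero (fun i => R • x i) T) (x i)
    rw [real_inner_smul_left, real_inner_self_eq_norm_sq, hx i] at h1
    rw [hx i] at h3
    linarith
  by_cases h : S ⊆ T
  · obtain ⟨i, hiT, hiS⟩ := Finset.not_subset.1 fun h' => hST (h.antisymm h')
    rw [dist_comm]
    exact main T S i hiT hiS
  · obtain ⟨i, hiS, hiT⟩ := Finset.not_subset.1 h
    exact main S T i hiS hiT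

/-- The point of the unit sphere above the grid point `δ k`. -/
def sphereGridPoint {n m : ℕ} (δ : ℝ) (k : Fin n → Fin (m + 1)) : Euc (n + 1) :=
  WithLp.toLp 2 (Fin.cons (√(1 - ∑ j, (δ * ((k j : ℕ) : ℝ)) ^ 2))
    fun j => δ * ((k j : ℕ) : ℝ))

lemma norm_sphereGridPoint {n m : ℕ} {δ : ℝ} (hδ : 0 ≤ δ) (h : δ * m * n ≤ 1)
    (k : Fin n → Fin (m + 1)) : ‖sphereGridPoint δ k‖ = 1 := by
  have hsum : ∑ j, (δ * ((k j : ℕ) : ℝ)) ^ 2 ≤ 1 := by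
    rcases Nat.eq_zero_or_pos n with rfl | hn
    · simp
    have hn' : (1 : ℝ) ≤ n := by exact_mod_cast hn
    calc ∑ j, (δ * ((k j : ℕ) : ℝ)) ^ 2 ≤ ∑ _j : Fin n, (δ * m) ^ 2 := by
          gcongr with j
          exact_mod_cast Nat.lt_succ_iff.1 (k j).2
      _ = n * (δ * m) ^ 2 := by simp
      _ ≤ (δ * m * n) ^ 2 := by
          have := sq_nonneg (δ * m)
          nlinarith [mul_nonneg (mul_nonneg (by linarith : (0 : ℝ) ≤ n) this)
            (by linarith : (0 : ℝ) ≤ n - 1)]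
      _ ≤ 1 := pow_le_one₀ (by positivity) h
  have h2 : ‖sphereGridPoint δ k‖ ^ 2 = 1 := by
    rw [EuclideanSpace.real_norm_sq_eq, Fin.sum_univ_succ]
    simp only [sphereGridPoint, Fin.cons_zero, Fin.cons_succ]
    rw [Real.sq_sqrt (by linarith)]
    ring
  exact (pow_eq_one_iff_of_nonneg (norm_nonneg _) two_ne_zero).1 h2

/-- Distinct grid indices move some coordinate by at least δ, and for unit vectors the inner product
is 1 minus half the squared distance. -/
lemma inner_sphereGridPoint_le {n m : ℕ} {δ : ℝ} (hδ : 0 ≤ δ) (h : δ * m * n ≤ 1)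
    {k l : Fin n → Fin (m + 1)} (hkl : k ≠ l) :
    inner ℝ (sphereGridPoint δ k) (sphereGridPoint δ l) ≤ 1 - δ ^ 2 / 2 := by
  obtain ⟨j, hj⟩ := Function.ne_iff.1 hkl
  have h1 : (1 : ℝ) ≤ (((k j : ℕ) : ℝ) - ((l j : ℕ) : ℝ)) ^ 2 := by
    have h0 : ((k j : ℕ) : ℤ) - ((l j : ℕ) : ℤ) ≠ 0 := by
      intro h0
      apply hj
      ext
      omega
    have := Int.one_le_abs h0
    rw [← sq_abs]
    have h2 : (1 : ℝ) ≤ |((k j : ℕ) : ℝ) - ((l j : ℕ) : ℝ)| := by exact_mod_cast this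
    exact one_le_pow₀ h2
  have h2 : δ ≤ ‖sphereGridPoint δ k - sphereGridPoint δ l‖ := by
    refine le_trans ?_ (abs_apply_le_norm _ j.succ)
    apply le_of_sq_le_sq _ (abs_nonneg _)
    rw [sq_abs]
    simp only [sphereGridPoint, PiLp.sub_apply, Fin.cons_succ, ← mul_sub, mul_pow]
    exact le_mul_of_one_le_right (sq_nonneg δ) h1
  have h3 := norm_sub_sq_real (sphereGridPoint δ k) (sphereGridPoint δ l)
  rw [norm_sphereGridPoint hδ h, norm_sphereGridPoint hδ h] at h3
  have h4 : δ ^ 2 ≤ ‖sphereGridPoint δ k - sphereGridPoint δ l‖ ^ 2 := by gcongr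
  linarith

lemma le_metricEntropy_convexClass_of_le {n : ℕ} (hn : 1 ≤ n) {p : ℝ≥0∞} {R : ℝ} {ε : ℝ≥0}
    (hR : 0 < R) (hε : 0 < ε) (hεR : 4 * (ε : ℝ) ≤ R) :
    ((Real.log 2 / (3 * n) ^ n * (R / ε) ^ ((n : ℝ) / 2) : ℝ) : EReal) ≤
      metricEntropy (convexClass (n + 1) p R) ε := by
  have hε' : (0 : ℝ) < ε := hε
  have hn' : (1 : ℝ) ≤ n := by exact_mod_cast hn
  -- This makes the separation R δ²/2 equal to 4ε, which exceeds 2ε; the hypothesis 4ε ≤ R is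
  -- exactly δ²/2 ≤ 1.
  set δ : ℝ := √(8 * ε / R) with hδ
  have hδpos : 0 < δ := by positivity
  have hδsq : δ ^ 2 = 8 * ε / R := Real.sq_sqrt (by positivity)
  -- The largest m for which the grid still lifts to the sphere; there are 2^((m+1)^n) subsets of
  -- grid points.
  set m : ℕ := ⌊1 / (δ * n)⌋₊ with hm
  have hm1 : δ * m * n ≤ 1 := by
    have h1 : (m : ℝ) ≤ 1 / (δ * n) := Nat.floor_le (by positivity)
    rw [le_div_iff₀ (by positivity)] at h1
    linarith
  have hm2 : 1 / (δ * n) ≤ m + 1 := (Nat.lt_floor_add_one _).le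
  have hθ : δ ^ 2 / 2 ≤ 1 := by
    rw [hδsq, div_div, div_le_one (by positivity)]
    linarith
  have hcard := card_le_externalCoveringNumber_of_dist (A := convexClass (n + 1) p R) (ε := ε)
    (ι := Finset (Fin n → Fin (m + 1)))
    (fun S => hullWithZero (fun k => R • sphereGridPoint δ k) S)
    (fun S => mem_convexClass_of_subset_closedBall
      (hullWithZero_subset_closedBall hR.le (fun k => by
        rw [norm_smul, norm_sphereGridPoint hδpos.le hm1, mul_one, Real.norm_of_nonneg hR.le]) S))
    (fun S T hST => by
      refine lt_of_lt_of_le ?_ (mul_le_dist_hullWithZero hR hθ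
        (norm_sphereGridPoint hδpos.le hm1)
        (fun k l hkl => inner_sphereGridPoint_le hδpos.le hm1 hkl) hST)
      have : R * (δ ^ 2 / 2) = 4 * ε := by rw [hδsq]; field_simp; norm_num
      rw [this]
      linarith)
  refine le_metricEntropy_of_le_externalCoveringNumber Fintype.card_pos hcard ?_
  rw [Fintype.card_finset, Fintype.card_fun, Fintype.card_fin, Fintype.card_fin, Nat.cast_pow,
    Real.log_pow, mul_comm _ (Real.log _), Nat.cast_ofNat, div_mul_eq_mul_div, mul_div_assoc]
  refine mul_le_mul_of_nonneg_left ?_ (Real.log_nonneg (by norm_num))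
  have h1 : √(R / ε) / (3 * n) ≤ m + 1 := by
    refine le_trans ?_ hm2
    rw [div_le_div_iff₀ (by positivity) (by positivity)]
    have h2 : √(R / ε) * δ ≤ 3 := by
      rw [hδ, ← Real.sqrt_mul (by positivity)]
      apply Real.sqrt_le_iff.2 ⟨by norm_num, ?_⟩
      have : R / ε * (8 * ε / R) = 8 := by field_simp
      rw [this]
      norm_num
    nlinarith
  calc (R / ε) ^ ((n : ℝ) / 2) / (3 * n) ^ n = (√(R / ε) / (3 * n)) ^ n := by
        rw [div_pow, Real.sqrt_eq_rpow, ← Real.rpow_mul_natCast (by positivity)]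
        congr 2
        ring
    _ ≤ (m + 1 : ℝ) ^ n := by gcongr
    _ = _ := by push_cast; rfl

/-- The singletons at R e and -R e are 2R > 2ε apart. This serves the range R/4 < ε < R, where the
cap construction is unavailable. -/
lemma log_two_le_metricEntropy_convexClass {d : ℕ} (hd : 0 < d) {p : ℝ≥0∞} {R : ℝ} {ε : ℝ≥0}
    (hR : 0 < R) (hεR : (ε : ℝ) < R) :
    ((Real.log 2 : ℝ) : EReal) ≤ metricEntropy (convexClass d p R) ε := by
  let e : Euc d := EuclideanSpace.single ⟨0, hd⟩ 1
  have he : ‖e‖ = 1 := by simp [e]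
  let P : Bool → ConvexBody (Euc d) := fun b =>
    ⟨{(if b then R else -R) • e}, convex_singleton _, isCompact_singleton,
      Set.singleton_nonempty _⟩
  have hP : ∀ b, P b ∈ convexClass d p R := by
    intro b
    refine mem_convexClass_of_subset_closedBall ?_
    rintro _ rfl
    rw [mem_closedBall_zero_iff, norm_smul, he]
    cases b <;> simp [abs_of_pos hR]
  have hdist : dist (P true) (P false) = 2 * R := by
    change hausdorffDist {(if true then R else -R) • e} {(if false then R else -R) • e} = 2 * R
    rw [hausdorffDist_singleton, dist_eq_norm]
    simp only [if_true, Bool.false_eq_true, if_false]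
    rw [← sub_smul, norm_smul, he, mul_one, Real.norm_of_nonneg (by linarith)]
    ring
  have hcard := card_le_externalCoveringNumber_of_dist (A := convexClass d p R) (ε := ε) P hP
    (fun b c hbc => by
      cases b <;> cases c <;> first | exact absurd rfl hbc | skip
      · rw [dist_comm, hdist]; linarith
      · rw [hdist]; linarith)
  refine le_metricEntropy_of_le_externalCoveringNumber Fintype.card_pos hcard ?_
  simp

end

/-! ### Assembly of the two bounds -/

theorem theorem7 (d : ℕ) (hd : 2 ≤ d) :
    ∃ c₁ c₂ : ℝ, 0 < c₁ ∧ 0 < c₂ ∧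
      ∀ (p : ℝ≥0∞) (R : ℝ) (ε : ℝ≥0), 1 ≤ p → 0 < R → 0 < ε →
        ((ε : ℝ) < R →
          ((c₁ * (R / (ε : ℝ)) ^ (((d : ℝ) - 1) / 2) : ℝ) : EReal) ≤
            metricEntropy (convexClass d p R) ε) ∧
        metricEntropy (convexClass d p R) ε ≤
          ((c₂ * (R / (ε : ℝ)) ^ (((d : ℝ) - 1) / 2) : ℝ) : EReal) := by
  obtain ⟨n, rfl⟩ : ∃ n, d = n + 1 := ⟨d - 1, by omega⟩
  have hn : 1 ≤ n := by omega
  have hn' : (1 : ℝ) ≤ n := by exact_mod_cast hn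
  obtain ⟨C, hC, hCK⟩ := exists_subset_closedBall_of_mem_convexClass (n + 1) (by omega)
  have hlog2 : 0 < Real.log 2 := Real.log_pos (by norm_num)
  have hlog : 0 < Real.log (2 * (8 * ((n : ℝ) + 1)) + 1) := Real.log_pos (by linarith)
  have hcode : 0 < codeConst n := by unfold codeConst; positivity
  have hexp : (((n + 1 : ℕ) : ℝ) - 1) / 2 = (n : ℝ) / 2 := by push_cast; ring
  rw [hexp]
  refine ⟨Real.log 2 / (3 * n) ^ n, codeConst n * 4 ^ n * C ^ ((n : ℝ) / 2), by positivity,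
    by positivity, fun p R ε hp hR hε => ⟨fun hεR => ?_, ?_⟩⟩
  · have hε' : (0 : ℝ) < ε := hε
    rcases le_or_gt (4 * (ε : ℝ)) R with h | h
    · exact le_metricEntropy_convexClass_of_le hn hR hε h
    -- Here R/ε < 4, so (R/ε)^(n/2) ≤ 2^n ≤ (3n)^n and the claimed bound is at most log 2.
    · refine le_trans ?_ (log_two_le_metricEntropy_convexClass (by omega) hR hεR)
      rw [EReal.coe_le_coe_iff, div_mul_eq_mul_div, div_le_iff₀ (by positivity)]
      refine mul_le_mul_of_nonneg_left ?_ hlog2.le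
      calc (R / ε) ^ ((n : ℝ) / 2) ≤ (4 : ℝ) ^ ((n : ℝ) / 2) := by
            apply Real.rpow_le_rpow (by positivity) _ (by positivity)
            rw [div_le_iff₀ hε']
            exact h.le
        _ = 2 ^ n := by
            rw [show (4 : ℝ) = 2 ^ (2 : ℝ) by norm_num, ← Real.rpow_mul (by norm_num),
              mul_div_cancel₀ _ (by norm_num), Real.rpow_natCast]
        _ ≤ (3 * n) ^ n := by gcongr; linarith
  · have h1 : externalCoveringNumber ε (convexClass (n + 1) p R) ≤
        externalCoveringNumber ε {K : ConvexBody (Euc (n + 1)) |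
          (K : Set (Euc (n + 1))) ⊆ closedBall 0 (C * R)} :=
      externalCoveringNumber_mono_set fun K hK => hCK p R hp hR K hK
    have h2 : metricEntropy (convexClass (n + 1) p R) ε ≤
        metricEntropy {K : ConvexBody (Euc (n + 1)) |
          (K : Set (Euc (n + 1))) ⊆ closedBall 0 (C * R)} ε :=
      ENNReal.log_le_log (by exact_mod_cast h1)
    refine h2.trans ((metricEntropy_subset_closedBall_le hn (mul_pos hC hR) hε).trans_eq ?_)
    rw [mul_div_assoc, Real.mul_rpow hC.le (by positivity), ← mul_assoc]
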